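/- Let $q_3 = x_1^2+x_2^2+x_3^2 \in \mathbb{C}[x_1,x_2,x_3]$, let $\mathbf{a}\cdot\mathbf{b}=a_1b_1+a_2b_2+a_3b_3$ denote the complex bilinear scalar product on $\mathbb{C}^3$, and let $\mathrm{O}_3(\mathbb{C})=\{A\in \mathbb{C}^{3\times 3} : A^{\mathsf T}A=I\}$. Let $\mathbf{a}_1,\dots,\mathbf{a}_6\in\mathbb{C}^3$. We say that six points $\mathbf{v}_1,\dots,\mathbf{v}_6\in\mathbb{R}^3$ are, up to opposite signs, the vertices of a regular icosahedron inscribed in the sphere of radius $R$ centred at the origin if $\{\pm\mathbf{v}_1,\dots,\pm\mathbf{v}_6\}$ is the set of the twelve vertices of such an icosahedron. (1) The points give a tight decomposition $$q_3^2=\sum_{j=1}^6(a_{j,1}x_1+a_{j,2}x_2+a_{j,3}x_3)^4$$ (tight: the number of summands is $\binom{s+n-1}{s}=6$ for $n=3$, $s=2$) if and only if there are points $\mathbf{v}_1,\dots,\mathbf{v}_6\in\mathbb{R}^3$ which are, up to opposite signs, the vertices of a regular icosahedron inscribed in the sphere of radius $(5/6)^{1/4}$ centred at the origin, a matrix $A\in\mathrm{O}_3(\mathbb{C})$,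 and fourth roots of unity $\varepsilon_1,\dots,\varepsilon_6\in\{\pm1,\pm\mathrm{i}\}$, such that $\mathbf{a}_j=\varepsilon_j A\mathbf{v}_j$ for every $j=1,\dots,6$. (2) The points give such a tight decomposition and satisfy $\mathbf{a}_j\cdot\mathbf{a}_j=(5/6)^{1/2}$ for every $j$ if and only if there are points $\mathbf{v}_1,\dots,\mathbf{v}_6\in\mathbb{R}^3$ which are, up to opposite signs, the vertices of a regular icosahedron inscribed in the sphere of radius $(5/6)^{1/4}$ centred at the origin, and a matrix $A\in\mathrm{O}_3(\mathbb{C})$, such that $\mathbf{a}_j=A\mathbf{v}_j$ for every $j=1,\dots,6$. -/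

import Mathlib

open scoped Matrix

noncomputable section

namespace Icosa

/-- The quadratic form `q_n = x_1^2 + ⋯ + x_n^2` with complex coefficients. -/
def quadForm (n : ℕ) : MvPolynomial (Fin n) ℂ :=
  ∑ i, MvPolynomial.X i ^ 2

/-- The linear form `a · x = a_1 x_1 + ⋯ + a_n x_n` attached to a point `a` of `ℂ^n`. -/
def linForm {n : ℕ} (a : Fin n → ℂ) : MvPolynomial (Fin n) ℂ :=
  ∑ i, MvPolynomial.C (a i) * MvPolynomial.X i

/-- The points `a_1, …, a_m` give a tight decomposition
`q_n^s = ∑_k (a_k · x)^(2s)`: the identity of polynomials holds and the number `m` of summands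
is `T_{n,s} = binom(s + n - 1, s)`. -/
def IsTightDecomposition (n s : ℕ) {m : ℕ} (a : Fin m → Fin n → ℂ) : Prop :=
  m = (s + n - 1).choose s ∧ quadForm n ^ s = ∑ k, linForm (a k) ^ (2 * s)

/-- The twelve vertices `(±φ, ±1, 0)`, `(0, ±φ, ±1)`, `(±1, 0, ±φ)` (signs independent) of
the standard regular icosahedron; indices are read modulo 3 and `φ = (1 + √5) / 2`. -/
def stdIcosahedron : Set (EuclideanSpace ℝ (Fin 3)) :=
  {v | ∃ k : Fin 3, (v k = Real.goldenRatio ∨ v k = -Real.goldenRatio) ∧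
    (v (k + 1) = 1 ∨ v (k + 1) = -1) ∧ v (k + 2) = 0}

/-- `V` is the vertex set of a regular icosahedron in Euclidean 3-space: it is the image of
the standard one under a similarity `x ↦ c + r L x`, with `r > 0` and `L` a linear isometry. -/
def IsRegularIcosahedron (V : Set (EuclideanSpace ℝ (Fin 3))) : Prop :=
  ∃ (c : EuclideanSpace ℝ (Fin 3)) (r : ℝ)
    (L : EuclideanSpace ℝ (Fin 3) ≃ₗᵢ[ℝ] EuclideanSpace ℝ (Fin 3)),
    0 < r ∧ V = (fun x => c + r • L x) '' stdIcosahedron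

/-- The six real points `v_1, …, v_6` are, up to opposite signs, the vertices of a regular
icosahedron inscribed in the sphere of radius `R` centred at the origin: the twelve vertices
are the points `±v_j`. -/
def AreIcosahedronVertices (R : ℝ) (v : Fin 6 → EuclideanSpace ℝ (Fin 3)) : Prop :=
  IsRegularIcosahedron (Set.range v ∪ Set.range (fun j => -v j)) ∧
    Set.range v ∪ Set.range (fun j => -v j) ⊆ Metric.sphere 0 R

/-- The inclusion of `ℝ^3` in `ℂ^3`. -/
def complexify (v : EuclideanSpace ℝ (Fin 3)) : Fin 3 → ℂ :=
  fun i => (v i : ℂ)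

end Icosa

end

/-! ### Pointwise forms of the polynomial identity -/

namespace Icosa

/-! Polarizing the identity gives all fourth moments of the points. Since six is also the dimension
of the space of ternary quadratic forms, these moments invert the square matrix of quadratic
monomials at the points. Reading the inverse on the other side yields `gram_relation`: every `a j ⬝ᵥ
a j` squares to 5/6, and off the diagonal the squared scalar products are one fifth of the products
of the self-products.

Fourth roots of unity make all self-products equal to `√(5/6)`, so the Gram matrix is known up to
signs. The tight frame relation makes the signs a symmetric conference matrix of order six, unique
up to switching and relabelling (`exists_relabelling`); hence the Gram matrix is that of an
icosahedron. Tight frames with equal Gram matrices differ by an orthogonal matrix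
(`exists_orthogonal_of_gram`).

Conversely, the icosahedron satisfies the quartic identity (`sum_inner_stdVertex_pow_four`), which
survives orthogonal maps and fourth roots of unity. -/

theorem eval_linForm {n : ℕ} (a x : Fin n → ℂ) :
    MvPolynomial.eval x (linForm a) = a ⬝ᵥ x := by
  simp [linForm, dotProduct]

theorem eval_quadForm {n : ℕ} (x : Fin n → ℂ) :
    MvPolynomial.eval x (quadForm n) = x ⬝ᵥ x := by
  simp [quadForm, dotProduct, sq]

theorem isTightDecomposition_iff (a : Fin 6 → Fin 3 → ℂ) :
    IsTightDecomposition 3 2 a ↔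
      ∀ x : Fin 3 → ℂ, ∑ j, (a j ⬝ᵥ x) ^ 4 = (x ⬝ᵥ x) ^ 2 := by
  constructor
  · rintro ⟨-, h⟩ x
    have := congrArg (MvPolynomial.eval x) h
    simpa [eval_linForm, eval_quadForm] using this.symm
  · intro h
    refine ⟨by decide, MvPolynomial.funext fun x => ?_⟩
    simpa [eval_linForm, eval_quadForm] using (h x).symm

/-- It is enough to test the identity at real points. -/
theorem isTightDecomposition_of_real (a : Fin 6 → Fin 3 → ℂ)
    (h : ∀ x : Fin 3 → ℝ, ∑ j, (a j ⬝ᵥ fun i => (x i : ℂ)) ^ 4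
      = ((fun i => (x i : ℂ)) ⬝ᵥ fun i => (x i : ℂ)) ^ 2) :
    IsTightDecomposition 3 2 a := by
  refine ⟨by decide, ?_⟩
  refine MvPolynomial.funext_set (fun _ : Fin 3 => Set.range ((↑) : ℝ → ℂ))
    (fun _ => Set.infinite_range_of_injective Complex.ofReal_injective) fun x hx => ?_
  choose y hy using fun i => hx i (Set.mem_univ i)
  obtain rfl : x = fun i => (y i : ℂ) := funext fun i => (hy i).symm
  simpa [eval_linForm, eval_quadForm] using (h y).symm

/-! ### Moments and the Gram relation -/

section Moments

variable {a : Fin 6 → Fin 3 → ℂ}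

theorem polarized (h : ∀ x : Fin 3 → ℂ, ∑ j, (a j ⬝ᵥ x) ^ 4 = (x ⬝ᵥ x) ^ 2)
    (x y z w : Fin 3 → ℂ) :
    ∑ j, (a j ⬝ᵥ x) * (a j ⬝ᵥ y) * (a j ⬝ᵥ z) * (a j ⬝ᵥ w) =
      1 / 3 * ((x ⬝ᵥ y) * (z ⬝ᵥ w) + (x ⬝ᵥ z) * (y ⬝ᵥ w) + (x ⬝ᵥ w) * (y ⬝ᵥ z)) := by
  -- Polarization of a quartic form: the sign of `x` is fixed, leaving 8 sign patterns, and 192 = 8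
  -- · 4!.
  have key : ∑ j, (a j ⬝ᵥ x) * (a j ⬝ᵥ y) * (a j ⬝ᵥ z) * (a j ⬝ᵥ w) =
      1 / 192 * (∑ j, (a j ⬝ᵥ (x + y + z + w)) ^ 4 - ∑ j, (a j ⬝ᵥ (x + y + z - w)) ^ 4
        - ∑ j, (a j ⬝ᵥ (x + y - z + w)) ^ 4 + ∑ j, (a j ⬝ᵥ (x + y - z - w)) ^ 4
        - ∑ j, (a j ⬝ᵥ (x - y + z + w)) ^ 4 + ∑ j, (a j ⬝ᵥ (x - y + z - w)) ^ 4
        + ∑ j, (a j ⬝ᵥ (x - y - z + w)) ^ 4 - ∑ j, (a j ⬝ᵥ (x - y - z - w)) ^ 4) := by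
    simp only [← Finset.sum_sub_distrib, ← Finset.sum_add_distrib, Finset.mul_sum]
    refine Finset.sum_congr rfl fun j _ => ?_
    simp only [dotProduct_add, dotProduct_sub]
    ring
  rw [key]
  simp only [h]
  simp only [dotProduct_add, dotProduct_sub, add_dotProduct, sub_dotProduct,
    dotProduct_comm y x, dotProduct_comm z x, dotProduct_comm w x, dotProduct_comm z y,
    dotProduct_comm w y, dotProduct_comm w z]
  ring

theorem moment (h : ∀ x : Fin 3 → ℂ, ∑ j, (a j ⬝ᵥ x) ^ 4 = (x ⬝ᵥ x) ^ 2) (k l m n : Fin 3) :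
    ∑ j, a j k * a j l * a j m * a j n =
      1 / 3 * ((if k = l then 1 else 0) * (if m = n then 1 else 0)
        + (if k = m then 1 else 0) * (if l = n then 1 else 0)
        + (if k = n then 1 else 0) * (if l = m then 1 else 0)) := by
  have := polarized h (Pi.single k 1) (Pi.single l 1) (Pi.single m 1) (Pi.single n 1)
  simpa [Pi.single_apply, eq_comm] using this

/-- Contraction of two indices in `moment`: (3 + 1 + 1) / 3 = 5/3. -/
theorem sum_norm_mul (h : ∀ x : Fin 3 → ℂ, ∑ j, (a j ⬝ᵥ x) ^ 4 = (x ⬝ᵥ x) ^ 2) (m n : Fin 3) :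
    ∑ j, (a j ⬝ᵥ a j) * (a j m * a j n) = if m = n then 5 / 3 else 0 := by
  have e : ∑ j, (a j ⬝ᵥ a j) * (a j m * a j n) =
      ∑ k, ∑ j, a j k * a j k * a j m * a j n := by
    rw [Finset.sum_comm]
    refine Finset.sum_congr rfl fun j _ => ?_
    rw [dotProduct, Finset.sum_mul]
    exact Finset.sum_congr rfl fun k _ => by ring
  rw [e]
  simp only [moment h]
  fin_cases m <;> fin_cases n <;> simp [Fin.sum_univ_three] <;> norm_num

/-- The pairs of indices `k ≤ l` that label the quadratic monomials in three variables. -/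
def pairFst : Fin 6 → Fin 3 := ![0, 1, 2, 0, 0, 1]

/-- See `pairFst`. -/
def pairSnd : Fin 6 → Fin 3 := ![0, 1, 2, 1, 2, 2]

/-- The values of the quadratic monomials at the points `a j`. -/
def veronese (a : Fin 6 → Fin 3 → ℂ) : Matrix (Fin 6) (Fin 6) ℂ :=
  fun j m => a j (pairFst m) * a j (pairSnd m)

/-- The coefficients of the quadratic forms `3/2 (a j · x)² - 3/10 (a j · a j) (x · x)`. -/
noncomputable def dualForms (a : Fin 6 → Fin 3 → ℂ) : Matrix (Fin 6) (Fin 6) ℂ :=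
  fun m j => (if pairFst m = pairSnd m then 3 / 2 else 3) * (a j (pairFst m) * a j (pairSnd m))
    - (if pairFst m = pairSnd m then 3 / 10 else 0) * (a j ⬝ᵥ a j)

/-- Any quadratic form `q` is recovered from its values at the points: `3/2 ∑ q(a j) (a j · x)²`
equals `q(x) + 1/2 tr(q) (x · x)` by `moment`, and the term with 3/10 removes the trace part by
`sum_norm_mul`. -/
theorem dualForms_mul_veronese (h : ∀ x : Fin 3 → ℂ, ∑ j, (a j ⬝ᵥ x) ^ 4 = (x ⬝ᵥ x) ^ 2) :
    dualForms a * veronese a = 1 := by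
  ext m n
  have e : (dualForms a * veronese a) m n =
      (if pairFst m = pairSnd m then 3 / 2 else 3) *
        (∑ j, a j (pairFst m) * a j (pairSnd m) * a j (pairFst n) * a j (pairSnd n))
      - (if pairFst m = pairSnd m then 3 / 10 else 0) *
        ∑ j, (a j ⬝ᵥ a j) * (a j (pairFst n) * a j (pairSnd n)) := by
    rw [Matrix.mul_apply, Finset.mul_sum, Finset.mul_sum, ← Finset.sum_sub_distrib]
    refine Finset.sum_congr rfl fun j _ => ?_
    simp only [dualForms, veronese]
    ring
  rw [e, moment h, sum_norm_mul h]
  fin_cases m <;> fin_cases n <;> simp [pairFst, pairSnd] <;> norm_num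

theorem veronese_mul_dualForms_apply (i j : Fin 6) :
    (veronese a * dualForms a) i j =
      3 / 2 * (a i ⬝ᵥ a j) ^ 2 - 3 / 10 * (a i ⬝ᵥ a i) * (a j ⬝ᵥ a j) := by
  simp [Matrix.mul_apply, Fin.sum_univ_succ, veronese, dualForms, pairFst, pairSnd, dotProduct]
  ring

/-- Tightness enters here: the matrices are square, so the left inverse is a right inverse, and its
entries are the dual forms evaluated at the points. -/
theorem gram_relation (h : ∀ x : Fin 3 → ℂ, ∑ j, (a j ⬝ᵥ x) ^ 4 = (x ⬝ᵥ x) ^ 2) (i j : Fin 6) :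
    3 / 2 * (a i ⬝ᵥ a j) ^ 2 - 3 / 10 * (a i ⬝ᵥ a i) * (a j ⬝ᵥ a j) = if i = j then 1 else 0 := by
  rw [← veronese_mul_dualForms_apply, mul_eq_one_comm.mp (dualForms_mul_veronese h),
    Matrix.one_apply]

theorem dotProduct_self_sq (h : ∀ x : Fin 3 → ℂ, ∑ j, (a j ⬝ᵥ x) ^ 4 = (x ⬝ᵥ x) ^ 2) (j : Fin 6) :
    (a j ⬝ᵥ a j) ^ 2 = 5 / 6 := by
  have := gram_relation h j j
  rw [if_pos rfl] at this
  linear_combination 5 / 6 * this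

end Moments

end Icosa

/-! ### Uniqueness of the sign matrix -/

namespace Icosa

section Signs

/-- The signs of the scalar products of the six vertices `stdVertex`. -/
def icosaSign : Fin 6 → Fin 6 → ℤ :=
  ![![0, 1, 1, 1, 1, 1],
    ![1, 0, -1, -1, 1, 1],
    ![1, -1, 0, 1, 1, -1],
    ![1, -1, 1, 0, -1, 1],
    ![1, 1, 1, -1, 0, -1],
    ![1, 1, -1, 1, -1, 0]]

/-- The sign coded by a Boolean. -/
def sg (b : Bool) : ℤ := if b then 1 else -1

theorem exists_sg {x : ℤ} (h : x = 1 ∨ x = -1) : ∃ b, x = sg b := by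
  rcases h with rfl | rfl
  exacts [⟨true, rfl⟩, ⟨false, rfl⟩]

/-- The relabellings, fixing `0` and `1`, of the pentagon formed by the positive signs. -/
def pentagonLabels : List (Fin 6 → Fin 6) :=
    [![0, 1, 4, 2, 3, 5], ![0, 1, 4, 2, 5, 3], ![0, 1, 4, 3, 2, 5],
     ![0, 1, 4, 5, 2, 3], ![0, 1, 4, 3, 5, 2], ![0, 1, 4, 5, 3, 2],
     ![0, 1, 2, 4, 3, 5], ![0, 1, 2, 4, 5, 3], ![0, 1, 3, 4, 2, 5],
     ![0, 1, 3, 4, 5, 2], ![0, 1, 2, 3, 4, 5], ![0, 1, 3, 2, 4, 5]]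

/-- Vanishing row sums make the positive signs a 2-regular graph on five vertices, hence one of the
4!/2 = 12 pentagons; `pentagonLabels` has one relabelling for each. -/
theorem pentagon_unique : ∀ t12 t13 t14 t15 t23 t24 t25 t34 t35 t45 : Bool,
    sg t12 + sg t13 + sg t14 + sg t15 = 0 →
    sg t12 + sg t23 + sg t24 + sg t25 = 0 →
    sg t13 + sg t23 + sg t34 + sg t35 = 0 →
    sg t14 + sg t24 + sg t34 + sg t45 = 0 →
    sg t15 + sg t25 + sg t35 + sg t45 = 0 →
    ∃ p ∈ pentagonLabels, p 0 = 0 ∧ Function.Injective p ∧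
      [sg t12, sg t13, sg t14, sg t15, sg t23, sg t24, sg t25, sg t34, sg t35, sg t45] =
        [icosaSign (p 1) (p 2), icosaSign (p 1) (p 3), icosaSign (p 1) (p 4), icosaSign (p 1) (p 5), icosaSign (p 2) (p 3),
          icosaSign (p 2) (p 4), icosaSign (p 2) (p 5), icosaSign (p 3) (p 4), icosaSign (p 3) (p 5), icosaSign (p 4) (p 5)] := by
  decide +kernel

/-- When row 0 is all ones off the diagonal, orthogonality to it says that the rows of the remaining
5 × 5 block sum to zero. -/
theorem exists_relabelling_of_row (T : Fin 6 → Fin 6 → ℤ) (hd : ∀ i, T i i = 0)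
    (hs : ∀ i j, T i j = T j i) (hpm : ∀ i j, i ≠ j → T i j = 1 ∨ T i j = -1)
    (h0 : ∀ j, j ≠ 0 → T 0 j = 1) (ho : ∀ k, k ≠ 0 → ∑ j, T 0 j * T j k = 0) :
    ∃ p : Fin 6 → Fin 6, Function.Injective p ∧ ∀ i j, T i j = icosaSign (p i) (p j) := by
  obtain ⟨t12, h12⟩ := exists_sg (hpm 1 2 (by decide))
  obtain ⟨t13, h13⟩ := exists_sg (hpm 1 3 (by decide))
  obtain ⟨t14, h14⟩ := exists_sg (hpm 1 4 (by decide))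
  obtain ⟨t15, h15⟩ := exists_sg (hpm 1 5 (by decide))
  obtain ⟨t23, h23⟩ := exists_sg (hpm 2 3 (by decide))
  obtain ⟨t24, h24⟩ := exists_sg (hpm 2 4 (by decide))
  obtain ⟨t25, h25⟩ := exists_sg (hpm 2 5 (by decide))
  obtain ⟨t34, h34⟩ := exists_sg (hpm 3 4 (by decide))
  obtain ⟨t35, h35⟩ := exists_sg (hpm 3 5 (by decide))
  obtain ⟨t45, h45⟩ := exists_sg (hpm 4 5 (by decide))
  have row : ∀ k, k ≠ 0 → T 1 k + T 2 k + T 3 k + T 4 k + T 5 k = 0 := fun k hk => by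
    have := ho k hk
    rw [Fin.sum_univ_six, hd 0, h0 1 (by decide), h0 2 (by decide), h0 3 (by decide),
      h0 4 (by decide), h0 5 (by decide)] at this
    linarith
  have r1 := row 1 (by decide)
  have r2 := row 2 (by decide)
  have r3 := row 3 (by decide)
  have r4 := row 4 (by decide)
  have r5 := row 5 (by decide)
  simp only [hd, hs 2 1, hs 3 1, hs 4 1, hs 5 1, hs 3 2, hs 4 2, hs 5 2, hs 4 3, hs 5 3, hs 5 4,
    h12, h13, h14, h15, h23, h24, h25, h34, h35, h45] at r1 r2 r3 r4 r5
  obtain ⟨p, -, p0, hp, e⟩ := pentagon_unique t12 t13 t14 t15 t23 t24 t25 t34 t35 t45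
    (by linarith) (by linarith) (by linarith) (by linarith) (by linarith)
  simp only [List.cons.injEq, and_true] at e
  obtain ⟨e12, e13, e14, e15, e23, e24, e25, e34, e35, e45⟩ := e
  refine ⟨p, hp, ?_⟩
  have hN : ∀ i, icosaSign i i = 0 := by decide
  have hNs : ∀ i j, icosaSign i j = icosaSign j i := by decide
  have hN0 : ∀ j, j ≠ 0 → icosaSign 0 j = 1 := by decide
  have lt : ∀ i j, i < j → T i j = icosaSign (p i) (p j) := by
    intro i j hij
    by_cases hi : i = 0
    · subst hi
      rw [p0, h0 j hij.ne', hN0]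
      exact fun h => hij.ne (hp (p0.trans h.symm))
    · fin_cases i <;> fin_cases j <;> first | exact absurd rfl hi | exact absurd hij (by decide) | skip
      exacts [h12.trans e12, h13.trans e13, h14.trans e14, h15.trans e15, h23.trans e23, h24.trans e24, h25.trans e25, h34.trans e34, h35.trans e35, h45.trans e45]
  intro i j
  rcases lt_trichotomy i j with h | rfl | h
  · exact lt i j h
  · rw [hd, hN]
  · rw [hs, hNs, lt j i h]

/-- A symmetric conference matrix of order six is unique up to switching and relabelling. -/
theorem exists_relabelling (S : Fin 6 → Fin 6 → ℤ) (hd : ∀ i, S i i = 0)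
    (hs : ∀ i j, S i j = S j i) (hpm : ∀ i j, i ≠ j → S i j = 1 ∨ S i j = -1)
    (ho : ∀ i k, i ≠ k → ∑ j, S i j * S j k = 0) :
    ∃ (p : Fin 6 → Fin 6) (σ : Fin 6 → ℤ), Function.Injective p ∧ (∀ i, σ i = 1 ∨ σ i = -1) ∧
      ∀ i j, S i j = σ i * σ j * icosaSign (p i) (p j) := by
  obtain ⟨σ, hσ, hσ0⟩ : ∃ σ : Fin 6 → ℤ, (∀ i, σ i = 1 ∨ σ i = -1) ∧
      ∀ j, j ≠ 0 → σ 0 * σ j * S 0 j = 1 := by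
    -- Switching by the entries of row 0 turns that row into ones.
    refine ⟨fun j => if j = 0 then 1 else S 0 j, fun j => ?_, fun j hj => ?_⟩
    · by_cases h : j = 0
      · simp [h]
      · simpa [h] using hpm 0 j (Ne.symm h)
    · rcases hpm 0 j (Ne.symm hj) with h | h <;> simp [hj, h]
  have hσ2 : ∀ i, σ i * σ i = 1 := fun i => by rcases hσ i with h | h <;> simp [h]
  obtain ⟨p, hp, e⟩ := exists_relabelling_of_row (fun i j => σ i * σ j * S i j)
    (fun i => by simp [hd]) (fun i j => by simp only [hs i j]; ring)
    (fun i j hij => by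
      rcases hσ i with h | h <;> rcases hσ j with h' | h' <;> rcases hpm i j hij with h'' | h'' <;>
        simp [h, h', h''])
    hσ0
    (fun k hk => by
      have : ∑ j, σ 0 * σ j * S 0 j * (σ j * σ k * S j k) =
          σ 0 * σ k * ∑ j, S 0 j * S j k := by
        rw [Finset.mul_sum]
        refine Finset.sum_congr rfl fun j _ => ?_
        linear_combination (σ 0 * S 0 j * σ k * S j k) * hσ2 j
      rw [this, ho 0 k hk.symm, mul_zero])
  refine ⟨p, σ, hp, hσ, fun i j => ?_⟩
  rw [← e]
  linear_combination (-(S i j) * σ j * σ j) * hσ2 i - S i j * hσ2 j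

end Signs

end Icosa

/-! ### The standard icosahedron -/

namespace Icosa

section Standard

/-- Six vertices of the standard icosahedron, one of each opposite pair. -/
noncomputable def stdVertex : Fin 6 → EuclideanSpace ℝ (Fin 3) :=
  ![!₂[Real.goldenRatio, 1, 0], !₂[Real.goldenRatio, -1, 0], !₂[0, Real.goldenRatio, 1],
    !₂[0, Real.goldenRatio, -1], !₂[1, 0, Real.goldenRatio], !₂[1, 0, -Real.goldenRatio]]

theorem eq_vec_three (v : EuclideanSpace ℝ (Fin 3)) : v = !₂[v 0, v 1, v 2] := by
  ext i
  fin_cases i <;> rfl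

theorem stdIcosahedron_eq :
    stdIcosahedron = Set.range stdVertex ∪ Set.range fun j => -stdVertex j := by
  ext v
  constructor
  · rintro ⟨k, h1, h2, h3⟩
    have neg : ∀ a b c : ℝ, (!₂[-a, -b, -c] : EuclideanSpace ℝ (Fin 3)) = -!₂[a, b, c] := by
      intro a b c
      ext i
      fin_cases i <;> simp
    rw [eq_vec_three v]
    fin_cases k
    · change v 0 = _ ∨ v 0 = _ at h1
      change v 1 = _ ∨ v 1 = _ at h2
      change v 2 = _ at h3
      rcases h1 with h1 | h1 <;> rcases h2 with h2 | h2 <;> rw [h1, h2, h3]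
      · exact Or.inl ⟨0, rfl⟩
      · exact Or.inl ⟨1, rfl⟩
      · exact Or.inr ⟨1, by simpa [stdVertex] using (neg Real.goldenRatio (-1) 0).symm⟩
      · exact Or.inr ⟨0, by simpa [stdVertex] using (neg Real.goldenRatio 1 0).symm⟩
    · change v 1 = _ ∨ v 1 = _ at h1
      change v 2 = _ ∨ v 2 = _ at h2
      change v 0 = _ at h3
      rcases h1 with h1 | h1 <;> rcases h2 with h2 | h2 <;> rw [h1, h2, h3]
      · exact Or.inl ⟨2, rfl⟩
      · exact Or.inl ⟨3, rfl⟩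
      · exact Or.inr ⟨3, by simpa [stdVertex] using (neg 0 Real.goldenRatio (-1)).symm⟩
      · exact Or.inr ⟨2, by simpa [stdVertex] using (neg 0 Real.goldenRatio 1).symm⟩
    · change v 2 = _ ∨ v 2 = _ at h1
      change v 0 = _ ∨ v 0 = _ at h2
      change v 1 = _ at h3
      rcases h1 with h1 | h1 <;> rcases h2 with h2 | h2 <;> rw [h1, h2, h3]
      · exact Or.inl ⟨4, rfl⟩
      · exact Or.inr ⟨5, by simpa [stdVertex] using (neg 1 0 (-Real.goldenRatio)).symm⟩
      · exact Or.inl ⟨5, rfl⟩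
      · exact Or.inr ⟨4, by simpa [stdVertex] using (neg 1 0 Real.goldenRatio).symm⟩
  · rintro (⟨j, rfl⟩ | ⟨j, rfl⟩)
    · refine ⟨![0, 0, 1, 1, 2, 2] j, ?_⟩
      fin_cases j <;> simp [stdVertex]
    · refine ⟨![0, 0, 1, 1, 2, 2] j, ?_⟩
      fin_cases j <;> simp [stdVertex]

theorem inner_stdVertex (i j : Fin 6) :
    inner ℝ (stdVertex i) (stdVertex j) =
      if i = j then Real.goldenRatio + 2 else Real.goldenRatio * icosaSign i j := by
  have h := Real.goldenRatio_sq
  rw [PiLp.inner_apply, Fin.sum_univ_three, stdVertex]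
  generalize Real.goldenRatio = φ at *
  fin_cases i <;> fin_cases j <;> simp [icosaSign] <;> linarith

theorem sum_stdVertex_mul (k l : Fin 3) :
    ∑ j, stdVertex j k * stdVertex j l =
      if k = l then 2 * (Real.goldenRatio + 2) else 0 := by
  have h := Real.goldenRatio_sq
  fin_cases k <;> fin_cases l <;>
    simp [stdVertex, Fin.sum_univ_six] <;> linarith

theorem sum_inner_stdVertex_pow_four (x : EuclideanSpace ℝ (Fin 3)) :
    ∑ j, inner ℝ (stdVertex j) x ^ 4 = 6 * Real.goldenRatio ^ 2 * inner ℝ x x ^ 2 := by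
  have h := Real.goldenRatio_sq
  simp only [stdVertex, PiLp.inner_apply, Fin.sum_univ_three, Fin.sum_univ_six]
  simp
  linear_combination ((2 * Real.goldenRatio ^ 2 + 2 * Real.goldenRatio - 2) *
    (x 0 ^ 4 + x 1 ^ 4 + x 2 ^ 4) + 6 * (x 0 ^ 2 + x 1 ^ 2 + x 2 ^ 2) ^ 2) * h

/-- Distinct indices have scalar product `±φ`, which cannot be `±(φ + 2)`. -/
theorem stdVertex_eq_or_neg {i j : Fin 6}
    (h : stdVertex i = stdVertex j ∨ stdVertex i = -stdVertex j) : i = j := by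
  by_contra hij
  have e := inner_stdVertex i j
  have hjj := inner_stdVertex j j
  rw [if_pos rfl] at hjj
  rw [if_neg hij] at e
  have hs : icosaSign i j = 1 ∨ icosaSign i j = -1 :=
    (by decide : ∀ i j, i ≠ j → icosaSign i j = 1 ∨ icosaSign i j = -1) i j hij
  have hφ := Real.goldenRatio_pos
  rcases h with h | h <;> rcases hs with s | s <;> rw [h, s] at e <;>
    simp only [inner_neg_left, hjj] at e <;> push_cast at e <;> linarith

end Standard

/-! ### Icosahedra on a sphere about the origin -/

section Vertices

variable {v : Fin 6 → EuclideanSpace ℝ (Fin 3)} {R : ℝ}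

/-- The vertices of an icosahedron on a sphere about the origin are, up to order and signs,
the images of the standard ones under a linear similarity. -/
theorem AreIcosahedronVertices.exists_isometry (h : AreIcosahedronVertices R v) :
    ∃ (r : ℝ) (L : EuclideanSpace ℝ (Fin 3) ≃ₗᵢ[ℝ] EuclideanSpace ℝ (Fin 3))
      (g : Equiv.Perm (Fin 6)), 0 < r ∧
      ∀ i, v (g i) = r • L (stdVertex i) ∨ v (g i) = -(r • L (stdVertex i)) := by
  obtain ⟨⟨c, r, L, hr, hV⟩, hS⟩ := h
  rw [hV] at hS
  have mem : ∀ i, stdVertex i ∈ stdIcosahedron ∧ -stdVertex i ∈ stdIcosahedron := fun i => by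
    rw [stdIcosahedron_eq]
    exact ⟨Or.inl ⟨i, rfl⟩, Or.inr ⟨i, rfl⟩⟩
  -- Opposite vertices `c ± r L v` have equal norm, so `c` is orthogonal to every `L v`; the quartic
  -- identity at `L.symm c` then forces `c = 0`.
  have hc : c = 0 := by
    have orth : ∀ i, inner ℝ (stdVertex i) (L.symm c) = 0 := fun i => by
      have h1 := hS ⟨_, (mem i).1, rfl⟩
      have h2 := hS ⟨_, (mem i).2, rfl⟩
      simp only [mem_sphere_zero_iff_norm] at h1 h2
      have h3 : inner ℝ c (L (stdVertex i)) = 0 := by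
        have e1 := norm_add_sq_real c (r • L (stdVertex i))
        have e2 := norm_sub_sq_real c (r • L (stdVertex i))
        rw [map_neg, smul_neg, ← sub_eq_add_neg] at h2
        rw [h1] at e1
        rw [h2] at e2
        rw [inner_smul_right] at e1 e2
        have : r * inner ℝ c (L (stdVertex i)) = 0 := by linarith
        exact (mul_eq_zero.mp this).resolve_left hr.ne'
      rw [real_inner_comm, ← L.inner_map_map, L.apply_symm_apply, h3]
    have q := sum_inner_stdVertex_pow_four (L.symm c)
    simp only [orth] at q
    have hφ := Real.goldenRatio_pos
    have : inner ℝ (L.symm c) (L.symm c) = (0 : ℝ) := by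
      have q' : 6 * Real.goldenRatio ^ 2 * inner ℝ (L.symm c) (L.symm c) ^ 2 = (0 : ℝ) := by
        simpa using q.symm
      have := (mul_eq_zero.mp q').resolve_left (by positivity)
      exact pow_eq_zero_iff (two_ne_zero) |>.mp this
    simpa using this
  subst hc
  have ex : ∀ i, ∃ j, v j = r • L (stdVertex i) ∨ v j = -(r • L (stdVertex i)) := fun i => by
    have : r • L (stdVertex i) ∈ Set.range v ∪ Set.range fun j => -v j := by
      rw [hV]
      exact ⟨_, (mem i).1, by simp⟩
    rcases this with ⟨j, hj⟩ | ⟨j, hj⟩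
    · exact ⟨j, Or.inl hj⟩
    · exact ⟨j, Or.inr (by rw [← hj, neg_neg])⟩
  choose g hg using ex
  have cancel : ∀ x y, r • L x = r • L y → x = y := fun x y hxy =>
    L.injective (smul_right_injective _ hr.ne' hxy)
  have ginj : Function.Injective g := by
    intro i j hij
    have hi := hg i
    have hj := hg j
    rw [← hij] at hj
    apply stdVertex_eq_or_neg
    rcases hi with hi | hi <;> rcases hj with hj | hj <;> rw [hi] at hj
    · exact Or.inl (cancel _ _ hj)
    · exact Or.inr (cancel _ _ (by rw [hj, map_neg, smul_neg]))
    · exact Or.inr (cancel _ _ (by rw [map_neg, smul_neg, ← hj, neg_neg]))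
    · exact Or.inl (cancel _ _ (neg_injective hj))
  exact ⟨r, L, Equiv.ofBijective g (Finite.injective_iff_bijective.mp ginj), hr, hg⟩

theorem AreIcosahedronVertices.norm_eq (h : AreIcosahedronVertices R v) (j : Fin 6) :
    ‖v j‖ = R := by
  simpa using h.2 (Or.inl ⟨j, rfl⟩)

theorem AreIcosahedronVertices.sum_inner_pow_four (h : AreIcosahedronVertices R v)
    (x : EuclideanSpace ℝ (Fin 3)) :
    ∑ j, inner ℝ (v j) x ^ 4 = 6 / 5 * R ^ 4 * inner ℝ x x ^ 2 := by
  have hn := h.norm_eq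
  obtain ⟨r, L, g, hr, hg⟩ := h.exists_isometry
  have hR : r ^ 2 * (Real.goldenRatio + 2) = R ^ 2 := by
    have e := inner_stdVertex 0 0
    rw [if_pos rfl, real_inner_self_eq_norm_sq] at e
    have : ‖v (g 0)‖ = r * ‖stdVertex 0‖ := by
      rcases hg 0 with h0 | h0 <;> rw [h0] <;> simp [norm_smul, abs_of_pos hr]
    rw [hn] at this
    rw [this, mul_pow, e]
  have hsum : ∑ j, inner ℝ (v j) x ^ 4 =
      ∑ i, r ^ 4 * inner ℝ (stdVertex i) (L.symm x) ^ 4 := by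
    rw [← Equiv.sum_comp g]
    refine Finset.sum_congr rfl fun i _ => ?_
    have e : inner ℝ (L (stdVertex i)) x = inner ℝ (stdVertex i) (L.symm x) := by
      have := L.inner_map_map (stdVertex i) (L.symm x)
      rwa [L.apply_symm_apply] at this
    rcases hg i with h0 | h0 <;> rw [h0] <;>
      simp only [inner_neg_left, real_inner_smul_left, e] <;> ring
  rw [hsum, ← Finset.mul_sum, sum_inner_stdVertex_pow_four, LinearIsometryEquiv.inner_map_map]
  have hφ := Real.goldenRatio_sq
  linear_combination (6 / 5 * inner ℝ x x ^ 2) *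
    ((r ^ 2 * (Real.goldenRatio + 2) + R ^ 2) * hR + r ^ 4 * 4 * hφ)

/-- Scaled, signed and permuted standard vertices are the vertices of an icosahedron. -/
theorem areIcosahedronVertices_of_eq {p : Fin 6 → Fin 6} (hp : Function.Injective p)
    {σ : Fin 6 → ℤ} (hσ : ∀ i, σ i = 1 ∨ σ i = -1) {r : ℝ} (hr : 0 < r) (hR : 0 ≤ R)
    (hrR : r ^ 2 * (Real.goldenRatio + 2) = R ^ 2)
    (hv : ∀ j, v j = (σ j * r) • stdVertex (p j)) : AreIcosahedronVertices R v := by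
  have hpm : ∀ j, v j = r • stdVertex (p j) ∨ v j = -(r • stdVertex (p j)) := fun j => by
    rw [hv]
    rcases hσ j with h | h <;> simp [h]
  constructor
  · refine ⟨0, r, LinearIsometryEquiv.refl ℝ _, hr, ?_⟩
    rw [stdIcosahedron_eq]
    ext x
    constructor
    · rintro (⟨j, rfl⟩ | ⟨j, rfl⟩) <;> rcases hpm j with h | h
      · exact ⟨_, Or.inl ⟨p j, rfl⟩, by simp [h]⟩
      · exact ⟨_, Or.inr ⟨p j, rfl⟩, by simp [h]⟩
      · exact ⟨_, Or.inr ⟨p j, rfl⟩, by simp [h]⟩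
      · exact ⟨_, Or.inl ⟨p j, rfl⟩, by simp [h]⟩
    · have hps := Finite.injective_iff_surjective.mp hp
      rintro ⟨y, ⟨i, rfl⟩ | ⟨i, rfl⟩, rfl⟩ <;> obtain ⟨j, rfl⟩ := hps i <;>
        rcases hpm j with h | h
      · exact Or.inl ⟨j, by simp [h]⟩
      · exact Or.inr ⟨j, by simp [h]⟩
      · exact Or.inr ⟨j, by simp [h]⟩
      · exact Or.inl ⟨j, by simp [h]⟩
  · have key : ∀ j, ‖v j‖ = R := fun j => by
      have e := inner_stdVertex (p j) (p j)
      rw [if_pos rfl, real_inner_self_eq_norm_sq] at e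
      have : ‖v j‖ = r * ‖stdVertex (p j)‖ := by
        rcases hpm j with h0 | h0 <;> rw [h0] <;> simp [norm_smul, abs_of_pos hr]
      rw [← abs_of_nonneg (norm_nonneg (v j)), ← abs_of_nonneg hR, ← sq_eq_sq_iff_abs_eq_abs,
        this, mul_pow, e, hrR]
    rintro x (⟨j, rfl⟩ | ⟨j, rfl⟩) <;> simp [key]

end Vertices

end Icosa

/-! ### From the Gram matrix to an orthogonal matrix -/

namespace Icosa

theorem complexify_dotProduct (v w : EuclideanSpace ℝ (Fin 3)) :
    complexify v ⬝ᵥ complexify w = ((inner ℝ v w : ℝ) : ℂ) := by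
  simp [complexify, dotProduct, PiLp.inner_apply, mul_comm]

theorem AreIcosahedronVertices.isTightDecomposition {R : ℝ}
    {v : Fin 6 → EuclideanSpace ℝ (Fin 3)} (h : AreIcosahedronVertices R v) (hR : R ^ 4 = 5 / 6) :
    IsTightDecomposition 3 2 fun j => complexify (v j) := by
  refine isTightDecomposition_of_real _ fun x => ?_
  have e := h.sum_inner_pow_four (WithLp.toLp 2 x)
  rw [hR, show (6 / 5 * (5 / 6) : ℝ) = 1 by norm_num, one_mul] at e
  change ∑ j, (complexify (v j) ⬝ᵥ complexify (WithLp.toLp 2 x)) ^ 4 =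
    (complexify (WithLp.toLp 2 x) ⬝ᵥ complexify (WithLp.toLp 2 x)) ^ 2
  simp only [complexify_dotProduct]
  exact_mod_cast e

theorem IsTightDecomposition.smul {a : Fin 6 → Fin 3 → ℂ} (h : IsTightDecomposition 3 2 a)
    {ε : Fin 6 → ℂ} (hε : ∀ j, ε j ^ 4 = 1) : IsTightDecomposition 3 2 fun j => ε j • a j := by
  rw [isTightDecomposition_iff] at h ⊢
  intro x
  simp only [smul_dotProduct, smul_eq_mul, mul_pow, hε, one_mul, h]

theorem mulVec_dotProduct_mulVec {A : Matrix (Fin 3) (Fin 3) ℂ}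
    (hA : A ∈ Matrix.orthogonalGroup (Fin 3) ℂ) (x y : Fin 3 → ℂ) :
    (A *ᵥ x) ⬝ᵥ (A *ᵥ y) = x ⬝ᵥ y := by
  rw [Matrix.mem_orthogonalGroup_iff'] at hA
  rw [Matrix.dotProduct_mulVec, Matrix.vecMul_mulVec, hA, Matrix.vecMul_one]

theorem IsTightDecomposition.mulVec {a : Fin 6 → Fin 3 → ℂ} (h : IsTightDecomposition 3 2 a)
    {A : Matrix (Fin 3) (Fin 3) ℂ} (hA : A ∈ Matrix.orthogonalGroup (Fin 3) ℂ) :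
    IsTightDecomposition 3 2 fun j => A *ᵥ a j := by
  rw [isTightDecomposition_iff] at h ⊢
  intro x
  have hx : x = A *ᵥ (Aᵀ *ᵥ x) := by
    rw [Matrix.mulVec_mulVec, Matrix.mem_orthogonalGroup_iff _ _ |>.mp hA, Matrix.one_mulVec]
  rw [hx]
  simp only [mulVec_dotProduct_mulVec hA, h]

/-- With constant self-product `s`, `sum_norm_mul` becomes a tight frame relation; 5/(3s) = 2s
because `s ^ 2 = 5 / 6`. -/
theorem sum_mul_of_norm {b : Fin 6 → Fin 3 → ℂ}
    (h : ∀ x : Fin 3 → ℂ, ∑ j, (b j ⬝ᵥ x) ^ 4 = (x ⬝ᵥ x) ^ 2) {s : ℂ}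
    (hs : s ^ 2 = 5 / 6) (hb : ∀ j, b j ⬝ᵥ b j = s) (m n : Fin 3) :
    ∑ j, b j m * b j n = if m = n then 2 * s else 0 := by
  have e := sum_norm_mul h m n
  simp only [hb, ← Finset.mul_sum] at e
  have hs0 : s ≠ 0 := fun h0 => by norm_num [h0] at hs
  apply mul_left_cancel₀ hs0
  rw [e]
  split_ifs
  · linear_combination -2 * hs
  · ring

/-- The integer signs of the scalar products of a normalized tight decomposition. -/
theorem exists_signs {b : Fin 6 → Fin 3 → ℂ}
    (h : ∀ x : Fin 3 → ℂ, ∑ j, (b j ⬝ᵥ x) ^ 4 = (x ⬝ᵥ x) ^ 2) {s t : ℂ} (ht : t ≠ 0)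
    (hst : s ^ 2 = 5 * t ^ 2) (hs : s ^ 2 = 5 / 6) (hb : ∀ j, b j ⬝ᵥ b j = s) :
    ∃ S : Fin 6 → Fin 6 → ℤ, (∀ i, S i i = 0) ∧ (∀ i j, S i j = S j i) ∧
      (∀ i j, i ≠ j → S i j = 1 ∨ S i j = -1) ∧
      (∀ i k, i ≠ k → ∑ j, S i j * S j k = 0) ∧ ∀ i j, i ≠ j → b i ⬝ᵥ b j = t * S i j := by
  have hpm : ∀ i j, i ≠ j → b i ⬝ᵥ b j = t ∨ b i ⬝ᵥ b j = -t := fun i j hij => by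
    have g := gram_relation h i j
    rw [hb, hb, if_neg hij] at g
    exact sq_eq_sq_iff_eq_or_eq_neg.mp (by linear_combination 2 / 3 * g + 1 / 5 * hst)
  have htt : t ≠ -t := fun e => ht (by linear_combination e / 2)
  let S : Fin 6 → Fin 6 → ℤ := fun i j => if i = j then 0 else if b i ⬝ᵥ b j = t then 1 else -1
  have hSd : ∀ i, S i i = 0 := fun i => if_pos rfl
  have hSb : ∀ i j, i ≠ j → b i ⬝ᵥ b j = t * S i j := fun i j hij => by
    rcases hpm i j hij with e | e <;> simp [S, hij, e, htt.symm]
  refine ⟨S, hSd, fun i j => ?_, fun i j hij => ?_, fun i k hik => ?_, hSb⟩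
  · simp only [S, dotProduct_comm (b j), eq_comm (a := j)]
  · by_cases e : b i ⬝ᵥ b j = t <;> simp [S, hij, e]
  · have frame : ∑ j, (b i ⬝ᵥ b j) * (b j ⬝ᵥ b k) = 2 * s * (b i ⬝ᵥ b k) := by
      have e' : ∑ j, (b i ⬝ᵥ b j) * (b j ⬝ᵥ b k) =
          ∑ m, ∑ n, b i m * b k n * ∑ j, b j m * b j n := by
        simp only [dotProduct, Finset.sum_mul_sum]
        simp only [Finset.mul_sum]
        rw [Finset.sum_comm]
        refine Finset.sum_congr rfl fun m _ => ?_
        rw [Finset.sum_comm]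
        exact Finset.sum_congr rfl fun n _ => Finset.sum_congr rfl fun j _ => by ring
      rw [e']
      simp only [sum_mul_of_norm h hs hb, mul_ite, mul_zero, Finset.sum_ite_eq, Finset.mem_univ, if_true]
      rw [dotProduct, Finset.mul_sum]
      exact Finset.sum_congr rfl fun m _ => by ring
    -- The terms `j = i` and `j = k` already exhaust the right side of `frame`, so the sign products
    -- must sum to zero.
    have split : ∀ j, (b i ⬝ᵥ b j) * (b j ⬝ᵥ b k) = t ^ 2 * (S i j * S j k : ℤ) +
        ((if j = i then s * (b i ⬝ᵥ b k) else 0) + if j = k then s * (b i ⬝ᵥ b k) else 0) := by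
      intro j
      by_cases h1 : j = i
      · subst h1
        simp [hik, hSd, hb]
      · by_cases h2 : j = k
        · subst h2
          simp [h1, hSd, hb, mul_comm]
        · simp only [h1, h2, if_false, hSb i j (Ne.symm h1), hSb j k h2]
          push_cast
          ring
    simp only [split, Finset.sum_add_distrib, Finset.sum_ite_eq', Finset.mem_univ, if_true,
      ← Finset.mul_sum] at frame
    have z : t ^ 2 * ∑ j, ((S i j * S j k : ℤ) : ℂ) = 0 := by linear_combination frame
    have := (mul_eq_zero.mp z).resolve_left (pow_ne_zero 2 ht)
    exact_mod_cast this

/-- Two systems of points with the same scalar products, both of them tight frames with the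
same constant, are related by an orthogonal matrix. -/
theorem exists_orthogonal_of_gram {b v : Fin 6 → Fin 3 → ℂ} {c : ℂ} (hc : c ≠ 0)
    (hb : ∀ m n, ∑ j, b j m * b j n = if m = n then c else 0)
    (hv : ∀ m n, ∑ j, v j m * v j n = if m = n then c else 0)
    (hbv : ∀ i j, b i ⬝ᵥ b j = v i ⬝ᵥ v j) :
    ∃ A ∈ Matrix.orthogonalGroup (Fin 3) ℂ, ∀ j, b j = A *ᵥ v j := by
  obtain ⟨B, hBb⟩ : ∃ B : Matrix (Fin 6) (Fin 3) ℂ, ∀ i j, B i j = b i j := ⟨Matrix.of b, by simp⟩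
  obtain ⟨V, hVv⟩ : ∃ V : Matrix (Fin 6) (Fin 3) ℂ, ∀ i j, V i j = v i j := ⟨Matrix.of v, by simp⟩
  have hB : Bᵀ * B = c • 1 := by
    ext m n
    simp [Matrix.mul_apply, hBb, hb, Matrix.one_apply]
  have hV : Vᵀ * V = c • 1 := by
    ext m n
    simp [Matrix.mul_apply, hVv, hv, Matrix.one_apply]
  have hBV : B * Bᵀ = V * Vᵀ := by
    ext i j
    simpa [Matrix.mul_apply, hBb, hVv, dotProduct] using hbv i j
  -- The witness is forced: `Bᵀ = A * Vᵀ` would give `Bᵀ * V = A * (Vᵀ * V) = c • A`.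
  refine ⟨c⁻¹ • (Bᵀ * V), ?_, fun j => ?_⟩
  · rw [Matrix.mem_orthogonalGroup_iff']
    have : (Bᵀ * V)ᵀ * (Bᵀ * V) = (c * c) • 1 := by
      calc (Bᵀ * V)ᵀ * (Bᵀ * V) = Vᵀ * (B * Bᵀ) * V := by
            simp only [Matrix.transpose_mul, Matrix.transpose_transpose, Matrix.mul_assoc]
        _ = (Vᵀ * V) * (Vᵀ * V) := by rw [hBV]; simp only [Matrix.mul_assoc]
        _ = (c * c) • 1 := by rw [hV]; simp [smul_smul]
    rw [Matrix.transpose_smul, Matrix.smul_mul, Matrix.mul_smul, this, smul_smul, smul_smul]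
    rw [show c⁻¹ * c⁻¹ * (c * c) = 1 by field_simp, one_smul]
  · have : (c⁻¹ • (Bᵀ * V)) * Vᵀ = Bᵀ := by
      rw [Matrix.smul_mul, Matrix.mul_assoc, ← hBV, ← Matrix.mul_assoc, hB, Matrix.smul_mul,
        smul_smul, inv_mul_cancel₀ hc, one_smul, Matrix.one_mul]
    ext i
    have e := congrFun (congrFun this i) j
    rw [Matrix.mul_apply] at e
    simpa only [Matrix.transpose_apply, hBb, hVv, Matrix.mulVec, dotProduct] using e.symm

theorem exists_icosahedron {b : Fin 6 → Fin 3 → ℂ} (h : IsTightDecomposition 3 2 b)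
    (hb : ∀ j, b j ⬝ᵥ b j = ((Real.sqrt (5 / 6) : ℝ) : ℂ)) {R : ℝ} (hR : 0 < R)
    (hR2 : R ^ 2 = Real.sqrt (5 / 6)) :
    ∃ v : Fin 6 → EuclideanSpace ℝ (Fin 3), AreIcosahedronVertices R v ∧
      ∃ A ∈ Matrix.orthogonalGroup (Fin 3) ℂ, ∀ j, b j = A *ᵥ complexify (v j) := by
  rw [isTightDecomposition_iff] at h
  have hφ := Real.goldenRatio_pos
  have hφ2 := Real.goldenRatio_sq
  set s : ℝ := Real.sqrt (5 / 6) with hs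
  have hs2 : s ^ 2 = 5 / 6 := Real.sq_sqrt (by norm_num)
  have hs' : (s : ℂ) ^ 2 = 5 / 6 := by rw [← Complex.ofReal_pow, hs2]; norm_num
  have hs0 : 0 < s := Real.sqrt_pos.mpr (by norm_num)
  -- The scale `r` matches the self-products `φ + 2` of the standard vertices to `s`; then `t = r²
  -- φ` fits since `(φ + 2)² = 5 φ²`.
  obtain ⟨r, hr, hr2⟩ : ∃ r : ℝ, 0 < r ∧ r ^ 2 * (Real.goldenRatio + 2) = s :=
    ⟨Real.sqrt (s / (Real.goldenRatio + 2)), Real.sqrt_pos.mpr (by positivity), by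
      rw [Real.sq_sqrt (by positivity)]; field_simp⟩
  set t : ℝ := r ^ 2 * Real.goldenRatio with ht
  have ht0 : 0 < t := by positivity
  have hst : s ^ 2 = 5 * t ^ 2 := by
    rw [ht, ← hr2]
    linear_combination (-4 * r ^ 4) * hφ2
  obtain ⟨S, hSd, hSs, hSpm, hSo, hSb⟩ := exists_signs h (s := s) (t := t)
    (by exact_mod_cast ht0.ne') (by exact_mod_cast hst) hs' hb
  obtain ⟨p, σ, hp, hσ, hpS⟩ := exists_relabelling S hSd hSs hSpm hSo
  let v : Fin 6 → EuclideanSpace ℝ (Fin 3) := fun j => (σ j * r) • stdVertex (p j)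
  have hσ2 : ∀ j, (σ j : ℝ) ^ 2 = 1 := fun j => by rcases hσ j with e | e <;> simp [e]
  refine ⟨v, areIcosahedronVertices_of_eq hp hσ hr hR.le (hr2.trans hR2.symm) fun _ => rfl, ?_⟩
  refine exists_orthogonal_of_gram (v := fun j => complexify (v j)) (c := 2 * (s : ℂ))
    (by exact_mod_cast (mul_pos two_pos hs0).ne') ?_ ?_ ?_
  · exact sum_mul_of_norm h hs' hb
  · intro m n
    have e := sum_stdVertex_mul m n
    rw [← (Equiv.ofBijective p (Finite.injective_iff_bijective.mp hp)).sum_comp] at e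
    have e2 : ∑ j, v j m * v j n = if m = n then 2 * s else 0 := by
      have : ∑ j, v j m * v j n = r ^ 2 * ∑ j, stdVertex (p j) m * stdVertex (p j) n := by
        rw [Finset.mul_sum]
        refine Finset.sum_congr rfl fun j _ => ?_
        simp only [v, PiLp.smul_apply, smul_eq_mul]
        linear_combination (r ^ 2 * stdVertex (p j) m * stdVertex (p j) n) * hσ2 j
      rw [this]
      simp only [Equiv.ofBijective_apply] at e
      rw [e]
      split_ifs
      · linear_combination 2 * hr2
      · simp
    simp only [complexify]
    have e3 := congrArg (fun x : ℝ => (x : ℂ)) e2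
    push_cast at e3
    rw [e3]
    split_ifs <;> simp
  · intro i j
    rw [complexify_dotProduct]
    simp only [v, real_inner_smul_left, real_inner_smul_right, inner_stdVertex]
    by_cases hij : i = j
    · subst hij
      rw [hb, if_pos rfl, ← hr2]
      congr 1
      linear_combination (-(r ^ 2) * (Real.goldenRatio + 2)) * hσ2 i
    · rw [hSb i j hij, if_neg (hp.ne hij), hpS, ht]
      push_cast
      ring

theorem exists_fourth_root {z : ℂ} {s : ℂ} (h : z ^ 2 = s ^ 2) :
    ∃ ε : ℂ, ε ^ 4 = 1 ∧ ε ^ 2 * z = s := by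
  rcases sq_eq_sq_iff_eq_or_eq_neg.mp h with e | e
  · exact ⟨1, by simp, by simp [e]⟩
  · exact ⟨Complex.I, Complex.I_pow_four, by simp [e]⟩

end Icosa

theorem mainTheorem7 (a : Fin 6 → Fin 3 → ℂ) :
    (Icosa.IsTightDecomposition 3 2 a ↔
      ∃ v : Fin 6 → EuclideanSpace ℝ (Fin 3),
        Icosa.AreIcosahedronVertices ((5 / 6 : ℝ) ^ (1 / 4 : ℝ)) v ∧
        ∃ A ∈ Matrix.orthogonalGroup (Fin 3) ℂ, ∃ ε : Fin 6 → ℂ,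
          (∀ j, ε j ^ 4 = 1) ∧ ∀ j, a j = ε j • (A *ᵥ Icosa.complexify (v j))) ∧
    ((Icosa.IsTightDecomposition 3 2 a ∧
        ∀ j, a j ⬝ᵥ a j = ((Real.sqrt (5 / 6) : ℝ) : ℂ)) ↔
      ∃ v : Fin 6 → EuclideanSpace ℝ (Fin 3),
        Icosa.AreIcosahedronVertices ((5 / 6 : ℝ) ^ (1 / 4 : ℝ)) v ∧
        ∃ A ∈ Matrix.orthogonalGroup (Fin 3) ℂ,
          ∀ j, a j = A *ᵥ Icosa.complexify (v j)) := by
  have hR : (0 : ℝ) < (5 / 6 : ℝ) ^ (1 / 4 : ℝ) := by positivity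
  have hR2 : ((5 / 6 : ℝ) ^ (1 / 4 : ℝ)) ^ 2 = Real.sqrt (5 / 6) := by
    rw [Real.sqrt_eq_rpow, ← Real.rpow_mul_natCast (by norm_num)]
    norm_num
  have hs2 : Real.sqrt (5 / 6) ^ 2 = 5 / 6 := Real.sq_sqrt (by norm_num)
  have hR4 : ((5 / 6 : ℝ) ^ (1 / 4 : ℝ)) ^ 4 = 5 / 6 := by
    rw [show ∀ x : ℝ, x ^ 4 = (x ^ 2) ^ 2 from fun x => by ring, hR2, hs2]
  refine ⟨⟨fun h => ?_, ?_⟩, ⟨fun ⟨h, hn⟩ => Icosa.exists_icosahedron h hn hR hR2, ?_⟩⟩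
  · have hq : ∀ j, ∃ ε : ℂ, ε ^ 4 = 1 ∧ ε ^ 2 * (a j ⬝ᵥ a j) = ((Real.sqrt (5 / 6) : ℝ) : ℂ) :=
      fun j => Icosa.exists_fourth_root (by
        rw [Icosa.dotProduct_self_sq ((Icosa.isTightDecomposition_iff a).mp h),
          ← Complex.ofReal_pow, hs2]
        norm_num)
    choose ε hε hεn using hq
    obtain ⟨v, hv, A, hA, e⟩ := Icosa.exists_icosahedron (h.smul hε)
      (fun j => by
        rw [smul_dotProduct, dotProduct_smul, smul_smul, smul_eq_mul, ← hεn j]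
        ring) hR hR2
    -- The cube of a fourth root of unity is its inverse, which undoes the normalization.
    refine ⟨v, hv, A, hA, fun j => ε j ^ 3, fun j => ?_, fun j => ?_⟩
    · rw [← pow_mul, mul_comm, pow_mul, hε, one_pow]
    · rw [← e, smul_smul, ← pow_succ, hε, one_smul]
  · rintro ⟨v, hv, A, hA, ε, hε, e⟩
    obtain rfl : a = fun j => ε j • (A *ᵥ Icosa.complexify (v j)) := funext e
    exact ((hv.isTightDecomposition hR4).mulVec hA).smul hε
  · rintro ⟨v, hv, A, hA, e⟩
    obtain rfl : a = fun j => A *ᵥ Icosa.complexify (v j) := funext e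
    refine ⟨(hv.isTightDecomposition hR4).mulVec hA, fun j => ?_⟩
    rw [Icosa.mulVec_dotProduct_mulVec hA, Icosa.complexify_dotProduct,
      real_inner_self_eq_norm_sq, hv.norm_eq, hR2]
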